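/- Let $p\ge 0$ be the number of threads per cluster node. There is a constant $C$, depending only on $p$, such that the following holds for every finite non-empty undirected graph $G=(V,E)$ with positive real edge weights, $n=|V|$, $m=|E|$, every $c\in\mathbb N$, and every rooted tree decomposition of $G$ with finitely many bags in which every bag other than the root bag has at most $c$ vertices. Let $w_m$ be the size of the root bag. Remove the root bag from the decomposition tree, and then recursively remove from each remaining component a centroid bag, i.e. a bag whose removal splits the component into components each of which retains at most half of the graph vertices of the component (the vertices that lie in its bags but in no bag removed before). This is always possible; let $T'$ be any resulting tree on the bags (the depth of a bag is the round in which it is removed). Then there is a ranking $R:V\to\{1,\dots,n\}$ (a bijection) determined by the minimum-depth bags in $T'$ (if the minimum depth of a bag containing $x$ is smaller than that for $y$, then $R(x)>R(y)$; the order among vertices of equal depth is chosen suitably) such that for every number $q\ge1$ of nodes, in every execution of the Hybrid algorithm for $(G,R)$ on $q$ nodes, at every time every node uses at most $$C\left(\frac{n\,(w_m+c\log n)}{q}+n+m\right)$$ words of main memory. Here the Hybrid algorithm is the following. Every node stores $G$ and $R$; node $i$ owns the roots $h$ with $R(h)\bmod q=i$ and stores the labels with these hubs only. Idle threads of a node take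 the owned roots in decreasing order of rank and construct the shortest path tree of the root $h$: if $h$ is among the first $k$ roots overall ($k$ arbitrary), by PLaNT (Dijkstra's algorithm that propagates the most important ancestor $a[v]$, adds the label $(h,\delta_v)$ to $v$ when neither $v$ nor $a[v]$ outranks $h$, and terminates early when no queued vertex has ancestor $h$); otherwise by DGLL (Dijkstra's algorithm pruned by rank queries and by distance queries to the labels of the node, with the new labels put into a local table). At a priori chosen synchronization points, arbitrary except that they are given by numbers of trees, the labels in the local tables are broadcast in packets of at most $n$ labels, all nodes answer the cleaning queries together, redundant labels are deleted and the others are moved to the global table of their owner. Memory counts the graph, the ranking, the task queue, both label tables, the distance and ancestor arrays, priority queues and hashed root labels of the $p$ threads, and the packet being checked with its answers, in words holding one vertex, weight or distance each. -/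

import Mathlib

namespace HubLabeling

noncomputable section

universe u v

/-! ### Weighted graphs and relaxed tree decompositions -/

/-- A finite undirected graph with positive real edge weights. -/
structure WeightedGraph (V : Type u) where
  graph : SimpleGraph V
  weight : V → V → ℝ
  weight_symm : ∀ x y, weight x y = weight y x
  weight_pos : ∀ x y, graph.Adj x y → 0 < weight x y

/-- A rooted tree decomposition all of whose bags, except possibly the root bag, have at most `c`
vertices. -/
structure RelaxedTreeDecomposition {V : Type u} (G : SimpleGraph V) (ι : Type v) (c : ℕ) where
  tree : SimpleGraph ι
  isTree : tree.IsTree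
  root : ι
  bag : ι → Finset V
  vertex_mem : ∀ x, ∃ t, x ∈ bag t
  edge_mem : ∀ x y, G.Adj x y → ∃ t, x ∈ bag t ∧ y ∈ bag t
  connected : ∀ x, (tree.induce {t | x ∈ bag t}).Connected
  card_bag_le : ∀ t, t ≠ root → (bag t).card ≤ c

namespace RelaxedTreeDecomposition

variable {V : Type u} {G : SimpleGraph V} {ι : Type v} {c : ℕ}

/-- The size `w_m` of the root bag. -/
def rootWidth (D : RelaxedTreeDecomposition G ι c) : ℕ := (D.bag D.root).card

/-- `dep t` is read as the round in which the bag `t` is removed from the tree. `D.part dep t` is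
the component containing `t` of the forest that is left immediately before that round; in the
tree `T'` of the removal process it is the set of descendants of `t` (including `t`). -/
def part (D : RelaxedTreeDecomposition G ι c) (dep : ι → ℕ) (t : ι) : Set ι :=
  {s | ∃ p : D.tree.Walk t s, ∀ x ∈ p.support, dep t ≤ dep x}

/-- The graph vertices that occur only in bags of `K`. If `K` is a component of what is left of
the tree, these are the vertices in the bags of `K` that lie in no bag removed so far. -/
def population (D : RelaxedTreeDecomposition G ι c) (K : Set ι) : Set V :=
  {x | ∀ t, x ∈ D.bag t → t ∈ K}

/-- `dep` is the depth function of the tree `T'` that has the root of `D` as its root and, below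
it, centroid decompositions of the components of the tree without its root: in every round, each
remaining component loses exactly one bag, and (after the root) this bag is a centroid of the
component, that is, each of the components into which its removal splits the component retains
at most half of the graph vertices. -/
structure IsCentroidDepth (D : RelaxedTreeDecomposition G ι c) (dep : ι → ℕ) : Prop where
  root_depth : dep D.root = 0
  at_most_one : ∀ t s, s ∈ D.part dep t → dep s = dep t → s = t
  at_least_one : ∀ t d, d ≤ dep t → ∃ s, dep s = d ∧ t ∈ D.part dep s
  centroid : ∀ t s, t ≠ D.root → s ∈ D.part dep t → dep s = dep t + 1 →
    2 * (D.population (D.part dep s)).ncard ≤ (D.population (D.part dep t)).ncard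

/-- The depth of the minimum-depth bag containing `x`. -/
def level (D : RelaxedTreeDecomposition G ι c) (dep : ι → ℕ) (x : V) : ℕ :=
  sInf {d | ∃ t, x ∈ D.bag t ∧ dep t = d}

end RelaxedTreeDecomposition

/-! ### Rankings -/

/-- A network hierarchy; a larger value means a more important vertex. -/
abbrev Ranking (V : Type u) [Fintype V] := V ≃ Fin (Fintype.card V)

namespace Ranking

variable {V : Type u} [Fintype V]

/-- The rank `R(x)`, a number in `{1, …, n}`. -/
def rank (R : Ranking V) (x : V) : ℕ := (R x : ℕ) + 1

/-- The position `n - R(x)` of the tree rooted at `x` in the order of construction. -/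
def treeId (R : Ranking V) (x : V) : ℕ := Fintype.card V - R.rank x

/-- The higher ranked one of two vertices. -/
def higher (R : Ranking V) (x y : V) : V := if R.rank x ≤ R.rank y then y else x

/-- Vertices whose minimum-depth bag is nearer to the root are ranked higher. -/
def DeterminedBy {G : SimpleGraph V} {ι : Type v} {c : ℕ} (R : Ranking V)
    (D : RelaxedTreeDecomposition G ι c) (dep : ι → ℕ) : Prop :=
  ∀ x y, D.level dep x < D.level dep y → R.rank y < R.rank x

/-- The set `TQ_i` of roots assigned to node `i` (rank circular distribution). -/
def taskQueue (R : Ranking V) (q : ℕ) (i : Fin q) : Finset V :=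
  Finset.univ.filter (fun x => R.rank x % q = (i : ℕ))

end Ranking

/-! ### The state of a cluster -/

/-- `(x, h, d)` is the label `(h, d)` in the label set of the vertex `x`. -/
abbrev Label (V : Type u) := V × V × WithTop ℝ

/-- The working memory of a thread that constructs the shortest path tree rooted at `hub`: the
distance array, the ancestor array (used by PLaNT), the priority queue (keyed by `dist`), and the
hashed label set of the root (used by distance queries). -/
structure Search (V : Type u) where
  hub : V
  dist : V → WithTop ℝ
  anc : V → V
  queue : Finset V
  hash : Finset (V × WithTop ℝ)

/-- One cluster node running `p` threads: the roots that are still to be processed, the global and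
the local label table, and the threads (`none` is an idle thread). -/
structure NodeState (V : Type u) (p : ℕ) where
  todo : Finset V
  globalTable : Finset (Label V)
  localTable : Finset (Label V)
  thread : Fin p → Option (Search V)

/-- The state of `q` nodes: the nodes, the index of the current superstep, whether the cluster is
in the cleaning part of the superstep, and the packet of labels that has been broadcast to all
nodes and is being checked for redundancy. -/
structure Cluster (V : Type u) (q p : ℕ) where
  node : Fin q → NodeState V p
  superstep : ℕ
  cleaning : Bool
  packet : Finset (Label V)

/-- The free parameters of the Hybrid algorithm: the first `switch` trees are constructed by
PLaNT, the others by DGLL, and superstep `s` constructs the trees with position below `sync s`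
that have not been constructed before. -/
structure Schedule where
  switch : ℕ
  sync : ℕ → ℕ

/-! ### Shortest path tree construction -/

namespace Search

variable {V : Type u} [Fintype V] [DecidableEq V]

/-- The start of a search from `h`; `hash` is the label set of `h` for distance queries. -/
def start (h : V) (hash : Finset (V × WithTop ℝ)) : Search V where
  hub := h
  dist := fun x => if x = h then 0 else ⊤
  anc := fun x => x
  queue := {h}
  hash := hash

/-- `x` may be popped from the priority queue. -/
def IsMin (S : Search V) (x : V) : Prop :=
  x ∈ S.queue ∧ ∀ y ∈ S.queue, S.dist x ≤ S.dist y

/-- Popping `x` without exploring its edges. -/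
def drop (S : Search V) (x : V) : Search V := { S with queue := S.queue.erase x }

/-- The edge from `x` to `y` gives a shorter tentative distance to `y`. -/
def Improves (W : WeightedGraph V) (S : Search V) (x y : V) : Prop :=
  W.graph.Adj x y ∧ S.dist x + (W.weight x y : WithTop ℝ) < S.dist y

/-- The edge from `x` to `y` gives another path of the current tentative length to `y`. -/
def Equals (W : WeightedGraph V) (S : Search V) (x y : V) : Prop :=
  W.graph.Adj x y ∧ S.dist x + (W.weight x y : WithTop ℝ) = S.dist y

open scoped Classical in
/-- Popping `x` and relaxing its edges, as in Dijkstra's algorithm. -/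
def relax (W : WeightedGraph V) (S : Search V) (x : V) : Search V :=
  { S with
    dist := fun y => if Improves W S x y then S.dist x + (W.weight x y : WithTop ℝ) else S.dist y
    queue := S.queue.erase x ∪ Finset.univ.filter (fun y => Improves W S x y) }

open scoped Classical in
/-- Popping `x` and relaxing its edges, as in PLaNT: the most important vertex on the path to `x`
is propagated along with the distances, ties being resolved in favour of the higher rank. -/
def relaxAnc (W : WeightedGraph V) (R : Ranking V) (S : Search V) (x : V) : Search V :=
  { relax W S x with
    anc := fun y =>
      if Improves W S x y then R.higher (R.higher x (S.anc x)) y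
      else if Equals W S x y then R.higher (R.higher x (S.anc x)) (S.anc y)
      else S.anc y }

/-- Some queued vertex still has the root as its most important ancestor; otherwise PLaNT
terminates the search early. -/
def Active (S : Search V) : Prop := ∃ x ∈ S.queue, S.anc x = S.hub

/-- The distance query: the labels in `L` already witness a distance at most `S.dist x` between
the root and `x`. -/
def Covered (S : Search V) (L : Finset (Label V)) (x : V) : Prop :=
  ∃ h d d', (x, h, d) ∈ L ∧ (h, d') ∈ S.hash ∧ d + d' ≤ S.dist x

/-- The rank query or the distance query prunes the search at `x`. -/
def Pruned (R : Ranking V) (S : Search V) (L : Finset (Label V)) (x : V) : Prop :=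
  R.rank S.hub < R.rank x ∨ S.Covered L x

end Search

namespace NodeState

variable {V : Type u} [Fintype V] [DecidableEq V] {p : ℕ}

/-- All labels stored on a node. -/
def labels (N : NodeState V p) : Finset (Label V) := N.globalTable ∪ N.localTable

open scoped Classical in
/-- The label set, restricted to this node, of the vertex `x`. -/
def labelsOf (N : NodeState V p) (x : V) : Finset (V × WithTop ℝ) :=
  (N.labels.filter (fun l => l.1 = x)).image (fun l => l.2)

/-- Replace the search of thread `j`. -/
def setThread (N : NodeState V p) (j : Fin p) (S : Option (Search V)) : NodeState V p :=
  { N with thread := Function.update N.thread j S }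

/-- One step of one thread of a node, when trees with position below `limit` may be started. -/
inductive Step (W : WeightedGraph V) (R : Ranking V) (switch limit : ℕ) :
    NodeState V p → NodeState V p → Prop
  /-- An idle thread takes the highest ranked root from the task queue. -/
  | start (N : NodeState V p) (j : Fin p) (h : V) :
      N.thread j = none → h ∈ N.todo → (∀ x ∈ N.todo, R.rank x ≤ R.rank h) →
      R.treeId h < limit →
      Step W R switch limit N
        ({ N with todo := N.todo.erase h }.setThread j (some (Search.start h (N.labelsOf h))))
  /-- PLaNT pops a vertex `x` such that neither `x` nor its ancestor outranks the root. -/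
  | plantLabel (N : NodeState V p) (j : Fin p) (S : Search V) (x : V) :
      N.thread j = some S → R.treeId S.hub < switch → S.Active → S.IsMin x →
      R.rank (R.higher x (S.anc x)) ≤ R.rank S.hub →
      Step W R switch limit N
        ({ N with globalTable := insert (x, S.hub, S.dist x) N.globalTable }.setThread j
          (some (S.relaxAnc W R x)))
  /-- PLaNT pops a vertex `x` such that `x` or its ancestor outranks the root: no label is
  generated, but the exploration goes on. -/
  | plantExplore (N : NodeState V p) (j : Fin p) (S : Search V) (x : V) :
      N.thread j = some S → R.treeId S.hub < switch → S.Active → S.IsMin x →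
      R.rank S.hub < R.rank (R.higher x (S.anc x)) →
      Step W R switch limit N (N.setThread j (some (S.relaxAnc W R x)))
  /-- The variant in which the exploration stops at such a vertex; it is allowed as well. -/
  | plantSkip (N : NodeState V p) (j : Fin p) (S : Search V) (x : V) :
      N.thread j = some S → R.treeId S.hub < switch → S.Active → S.IsMin x →
      R.rank S.hub < R.rank (R.higher x (S.anc x)) →
      Step W R switch limit N (N.setThread j (some (S.drop x)))
  /-- PLaNT finishes a tree (in particular when its queue is empty). -/
  | plantExit (N : NodeState V p) (j : Fin p) (S : Search V) :
      N.thread j = some S → R.treeId S.hub < switch → ¬ S.Active →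
      Step W R switch limit N (N.setThread j none)
  /-- DGLL pops a vertex that is pruned. -/
  | dgllPrune (N : NodeState V p) (j : Fin p) (S : Search V) (x : V) :
      N.thread j = some S → switch ≤ R.treeId S.hub → S.IsMin x → S.Pruned R N.labels x →
      Step W R switch limit N (N.setThread j (some (S.drop x)))
  /-- DGLL pops a vertex that is not pruned. -/
  | dgllLabel (N : NodeState V p) (j : Fin p) (S : Search V) (x : V) :
      N.thread j = some S → switch ≤ R.treeId S.hub → S.IsMin x → ¬ S.Pruned R N.labels x →
      Step W R switch limit N
        ({ N with localTable := insert (x, S.hub, S.dist x) N.localTable }.setThread j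
          (some (S.relax W x)))
  /-- DGLL finishes a tree. -/
  | dgllExit (N : NodeState V p) (j : Fin p) (S : Search V) :
      N.thread j = some S → switch ≤ R.treeId S.hub → S.queue = ∅ →
      Step W R switch limit N (N.setThread j none)

end NodeState

/-! ### The distributed algorithm -/

namespace Cluster

variable {V : Type u} [Fintype V] [DecidableEq V] {q p : ℕ}

/-- The Hybrid algorithm starts with empty tables and the circularly distributed task queues. -/
def initial (R : Ranking V) (q p : ℕ) : Cluster V q p where
  node := fun i =>
    { todo := R.taskQueue q i, globalTable := ∅, localTable := ∅, thread := fun _ => none }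
  superstep := 0
  cleaning := false
  packet := ∅

/-- The cleaning query for a label `l = (x, h, d)`, answered by all nodes together: some common hub
`w` of `x` and `h` with `R(w) > R(h)` witnesses a distance at most `d` between them. -/
def Redundant (R : Ranking V) (K : Cluster V q p) (l : Label V) : Prop :=
  ∃ (i : Fin q) (w : V) (d d' : WithTop ℝ), (l.1, w, d) ∈ (K.node i).labels ∧
    (l.2.1, w, d') ∈ (K.node i).labels ∧ d + d' ≤ l.2.2 ∧ R.rank l.2.1 < R.rank w

open scoped Classical in
/-- The owner of a label of the current packet deletes it if it is redundant, and moves it from the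
local to the global table otherwise. -/
def cleanNode (R : Ranking V) (K : Cluster V q p) (i : Fin q) : NodeState V p :=
  { K.node i with
    globalTable := (K.node i).globalTable ∪
      ((K.node i).localTable ∩ K.packet).filter (fun l => ¬ K.Redundant R l)
    localTable := (K.node i).localTable \ K.packet }

/-- One step of the Hybrid algorithm. -/
inductive Step (W : WeightedGraph V) (R : Ranking V) (P : Schedule) :
    Cluster V q p → Cluster V q p → Prop
  /-- A thread of node `i` makes a step. -/
  | compute (K : Cluster V q p) (i : Fin q) (N : NodeState V p) :
      K.cleaning = false → (K.node i).Step W R P.switch (P.sync K.superstep) N →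
      Step W R P K { K with node := Function.update K.node i N }
  /-- All trees of the superstep are complete, and the nodes synchronize. -/
  | synchronize (K : Cluster V q p) :
      K.cleaning = false → (∀ i j, (K.node i).thread j = none) →
      (∀ i, ∀ x ∈ (K.node i).todo, P.sync K.superstep ≤ R.treeId x) →
      Step W R P K { K with cleaning := true }
  /-- A packet of at most `n` labels generated in this superstep is broadcast to all nodes. -/
  | broadcast (K : Cluster V q p) (A : Finset (Label V)) :
      K.cleaning = true → K.packet = ∅ → (∀ l ∈ A, ∃ i, l ∈ (K.node i).localTable) →
      A.card ≤ Fintype.card V →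
      Step W R P K { K with packet := A }
  /-- The answers to the cleaning queries for the packet are combined. -/
  | reduce (K : Cluster V q p) :
      K.cleaning = true →
      Step W R P K { K with node := fun i => K.cleanNode R i, packet := ∅ }
  /-- All labels of the superstep have been cleaned, and the next superstep begins. -/
  | advance (K : Cluster V q p) :
      K.cleaning = true → K.packet = ∅ → (∀ i, (K.node i).localTable = ∅) →
      Step W R P K { K with cleaning := false, superstep := K.superstep + 1 }

/-- `K` occurs in some execution of the Hybrid algorithm on `q` nodes with `p` threads each. -/
def Occurs (W : WeightedGraph V) (R : Ranking V) (P : Schedule) (K : Cluster V q p) : Prop :=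
  Relation.ReflTransGen (Step W R P) (initial R q p) K

/-! ### Memory, in words -/

/-- Adjacency lists: one header per vertex, and the neighbour and the weight for each entry. -/
def graphWords (W : WeightedGraph V) : ℕ := ∑ x, (1 + 2 * (W.graph.neighborSet x).ncard)

/-- The distance and ancestor arrays of a thread (which stay allocated) and, for a running search,
the root, a counter, the queue and the hashed labels of the root. -/
def threadWords : Option (Search V) → ℕ
  | none => 2 * Fintype.card V
  | some S => 2 * Fintype.card V + 2 + 2 * S.queue.card + 2 * S.hash.card

/-- The main memory in use on node `i`: the graph, the ranking, the task queue, the two label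
tables (a header per vertex, a hub and a distance per label), the threads, the packet being checked
(vertex, hub, distance and answer for each of its labels), and the superstep counter and flag. -/
def nodeMemory (W : WeightedGraph V) (K : Cluster V q p) (i : Fin q) : ℕ :=
  graphWords W + Fintype.card V + (K.node i).todo.card
    + (Fintype.card V + 2 * (K.node i).globalTable.card)
    + (Fintype.card V + 2 * (K.node i).localTable.card)
    + ∑ j, threadWords ((K.node i).thread j)
    + 4 * K.packet.card + 2

end Cluster

end

end HubLabeling

namespace HubLabeling

noncomputable section

universe u v

set_option linter.unusedSectionVars false

/-! ### Low-rank reachability and the invariant of one search. -/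

section Invariants

variable {V : Type u} [Fintype V]

/-! Apart from the label tables, a node holds O(n + m) words for fixed `p`
(`Cluster.Occurs.nodeMemory_le`), so the labels have to be counted. Correctness of distances plays
no role. Two invariants suffice: a node never holds two labels with the same vertex and hub, and a
label at `x` with hub `h` exists only if some path from `h` to `x` contains no vertex outranking `h`
(`LowReach`). Distance pruning and cleaning only lower the count. Hence a node has at most as many
labels as there are pairs of an owned hub `h` and a vertex `x` low-reachable from `h`.

Along such a path no vertex has a smaller level than `h`, so none lies in a bag removed before the
minimum-depth bag of `h`. The path therefore stays in the component of that bag, and `x` lies in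
`reachSet` of `h` (`LowReach.mem_reachSet`). For fixed `x` and fixed level, all such hubs lie in one
bag (`ncard_hubs_le`), so a level contributes at most `n * c` pairs in total, and level 0 at most `n
* w_m`. Since populations halve below depth 1, there are at most `Nat.log 2 n + 2` levels.

It remains to see that the circular distribution splits this total evenly. Within each level the
ranking is chosen so that `reachSet` sizes increase with rank. Then the share of a node in one level
exceeds the average by at most the largest `reachSet` of that level (`Ranking.mul_sum_owned_le`).
These maxima are at most `n` at level 0 and `n / 2 ^ d` at level `d + 1`, so the excess over all
levels is at most `3 * n`, with no logarithmic factor. -/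

theorem Ranking.rank_higher (R : Ranking V) (x y : V) :
    R.rank (R.higher x y) = max (R.rank x) (R.rank y) := by
  unfold Ranking.higher
  split_ifs with h
  · exact (max_eq_right h).symm
  · exact (max_eq_left (le_of_not_ge h)).symm

theorem Ranking.rank_injective (R : Ranking V) : Function.Injective R.rank := fun _ _ h =>
  R.injective (Fin.ext (Nat.succ_injective h))

/-- `x` can be reached from `h` by a path on which no vertex outranks `h`. -/
def LowReach (W : WeightedGraph V) (R : Ranking V) (h : V) : V → Prop :=
  Relation.ReflTransGen (fun x y => W.graph.Adj x y ∧ R.rank y ≤ R.rank h) h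

namespace Search

/-- A vertex that has left the queue for good. -/
def Settled (S : Search V) (x : V) : Prop :=
  x ∉ S.queue ∧ ∀ y ∈ S.queue, S.dist x ≤ S.dist y

/-- The invariant of a single search. -/
structure Valid (W : WeightedGraph V) (R : Ranking V) (S : Search V) : Prop where
  queue_ne_top : ∀ x ∈ S.queue, S.dist x ≠ ⊤
  reach : ∀ x, S.dist x ≠ ⊤ → R.rank (R.higher x (S.anc x)) ≤ R.rank S.hub →
    LowReach W R S.hub x
  hash_card : S.hash.card ≤ Fintype.card V

variable [DecidableEq V] {W : WeightedGraph V} {R : Ranking V} {S : Search V} {x y : V}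

theorem IsMin.settled_drop (h : S.IsMin x) : (S.drop x).Settled x :=
  ⟨by simp [drop], fun y hy => h.2 y (Finset.mem_of_mem_erase hy)⟩

theorem Settled.drop (h : S.Settled y) : (S.drop x).Settled y :=
  ⟨fun hy => h.1 (Finset.mem_of_mem_erase hy), fun z hz => h.2 z (Finset.mem_of_mem_erase hz)⟩

theorem Valid.drop (h : S.Valid W R) : (S.drop x).Valid W R :=
  ⟨fun y hy => h.queue_ne_top y (Finset.mem_of_mem_erase hy), h.reach, h.hash_card⟩

/-- The only use of the weights' sign is here and in `le_relax_dist`: as in Dijkstra's algorithm,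
popped distances never decrease, so a settled vertex never re-enters the queue. -/
theorem not_improves (h : S.dist y ≤ S.dist x) : ¬ S.Improves W x y := by
  rintro ⟨hadj, hlt⟩
  have hw : (0 : WithTop ℝ) ≤ (W.weight x y : WithTop ℝ) := by
    exact_mod_cast (W.weight_pos x y hadj).le
  exact absurd (h.trans (le_add_of_nonneg_right hw)) (not_le.mpr hlt)

theorem le_relax_dist (hx : S.IsMin x) {z : V} (hz : z ∈ (S.relax W x).queue) :
    S.dist x ≤ (S.relax W x).dist z := by
  classical
  simp only [relax]
  split_ifs with hi
  · have hw : (0 : WithTop ℝ) ≤ (W.weight x z : WithTop ℝ) := by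
      exact_mod_cast (W.weight_pos x z hi.1).le
    exact le_add_of_nonneg_right hw
  · simp only [relax, Finset.mem_union, Finset.mem_filter, hi, and_false, or_false] at hz
    exact hx.2 z (Finset.mem_of_mem_erase hz)

/-- Covers two cases at once: the vertex just popped, and a vertex settled earlier. -/
theorem settled_relax_of_le (hx : S.IsMin x) (hy : y ∉ S.queue.erase x)
    (hle : S.dist y ≤ S.dist x) : (S.relax W x).Settled y := by
  classical
  have hn := not_improves (W := W) hle
  refine ⟨?_, fun z hz => ?_⟩
  · simp only [relax, Finset.mem_union, Finset.mem_filter, hn, and_false, or_false]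
    exact hy
  · refine le_trans ?_ (hle.trans (le_relax_dist hx hz))
    simp [relax, hn]

theorem IsMin.settled_relax (h : S.IsMin x) : (S.relax W x).Settled x :=
  settled_relax_of_le h (by simp) le_rfl

theorem Settled.relax (hy : S.Settled y) (hx : S.IsMin x) : (S.relax W x).Settled y :=
  settled_relax_of_le hx (fun h => hy.1 (Finset.mem_of_mem_erase h)) (hy.2 x hx.1)

theorem relax_queue_ne_top (h : S.Valid W R) (y : V) (hy : y ∈ (S.relax W x).queue) :
    (S.relax W x).dist y ≠ ⊤ := by
  classical
  simp only [Search.relax]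
  split_ifs with hi
  · exact (lt_of_lt_of_le hi.2 le_top).ne
  · simp only [Search.relax, Finset.mem_union, Finset.mem_filter, hi, and_false, or_false] at hy
    exact h.queue_ne_top y (Finset.mem_of_mem_erase hy)

theorem LowReach.tail {h : V} (hx : LowReach W R h x) (hxy : W.graph.Adj x y)
    (hy : R.rank y ≤ R.rank h) : LowReach W R h y :=
  Relation.ReflTransGen.tail hx ⟨hxy, hy⟩

/-- DGLL leaves the ancestor array at its initial identity, so the premise of `reach` reduces to a
bound on the rank of the vertex itself. The rank query supplies this bound for `x`. -/
theorem Valid.relax (h : S.Valid W R) (hanc : ∀ y, S.anc y = y) (hx : S.IsMin x)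
    (hr : R.rank x ≤ R.rank S.hub) : (S.relax W x).Valid W R := by
  classical
  refine ⟨relax_queue_ne_top h, fun y hy hle => ?_, h.hash_card⟩
  change R.rank (R.higher y (S.anc y)) ≤ R.rank S.hub at hle
  change LowReach W R S.hub y
  by_cases hi : S.Improves W x y
  · have hxr := h.reach x (h.queue_ne_top x hx.1) (by rw [hanc, R.rank_higher]; simpa using hr)
    refine LowReach.tail hxr hi.1 ?_
    rw [R.rank_higher] at hle
    exact (le_max_left _ _).trans hle
  · exact h.reach y (by simpa [Search.relax, hi] using hy) hle

/-- After an improvement, the new ancestor of `y` dominates `x` and its ancestor. If it does not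
outrank the root, then `x` was low-reachable and the edge extends the path. A tie only raises the
rank of the ancestor, so the old premise for `y` still holds. -/
theorem Valid.relaxAnc (h : S.Valid W R) (hx : S.IsMin x) : (S.relaxAnc W R x).Valid W R := by
  classical
  refine ⟨relax_queue_ne_top h, fun y hy hle => ?_, h.hash_card⟩
  change LowReach W R S.hub y
  change R.rank (R.higher y ((S.relaxAnc W R x).anc y)) ≤ R.rank S.hub at hle
  change (S.relax W x).dist y ≠ ⊤ at hy
  simp only [Search.relaxAnc] at hle
  by_cases hi : S.Improves W x y
  · simp only [hi, if_true, R.rank_higher, max_le_iff] at hle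
    refine LowReach.tail (h.reach x (h.queue_ne_top x hx.1) ?_) hi.1 hle.1
    rw [R.rank_higher]
    exact max_le hle.2.1.1 hle.2.1.2
  · refine h.reach y (by simpa [Search.relax, hi] using hy) ?_
    by_cases he : S.Equals W x y
    · simp only [hi, he, if_true, if_false, R.rank_higher, max_le_iff] at hle
      rw [R.rank_higher]
      exact max_le hle.1 hle.2.2
    · simpa only [hi, he, if_false] using hle

theorem Valid.start {h : V} {hash : Finset (V × WithTop ℝ)}
    (hh : hash.card ≤ Fintype.card V) : (Search.start h hash).Valid W R := by
  refine ⟨fun x hx => ?_, fun x hx _ => ?_, hh⟩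
  · rw [show x = h by simpa [Search.start] using hx]
    simp [Search.start]
  · by_cases hxh : x = h
    · subst hxh; exact Relation.ReflTransGen.refl
    · simp [Search.start, hxh] at hx

end Search

/-! ### The invariant of one node. -/

namespace NodeState

variable [DecidableEq V] {p : ℕ} {W : WeightedGraph V} {R : Ranking V} {q i switch : ℕ}

/-- The invariant of a node that owns the roots `h` with `R(h) mod q = i`. -/
structure Valid (W : WeightedGraph V) (R : Ranking V) (q i switch : ℕ) (N : NodeState V p) :
    Prop where
  todo_owned : ∀ x ∈ N.todo, R.rank x % q = i
  label_owned : ∀ l ∈ N.labels, R.rank l.2.1 % q = i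
  label_reach : ∀ l ∈ N.labels, LowReach W R l.2.1 l.1
  label_todo : ∀ l ∈ N.labels, l.2.1 ∉ N.todo
  label_inj : ∀ l ∈ N.labels, ∀ l' ∈ N.labels, l.1 = l'.1 → l.2.1 = l'.2.1 → l = l'
  thread_valid : ∀ j S, N.thread j = some S → S.Valid W R
  thread_anc : ∀ j S, N.thread j = some S → switch ≤ R.treeId S.hub → ∀ x, S.anc x = x
  thread_owned : ∀ j S, N.thread j = some S → R.rank S.hub % q = i
  thread_todo : ∀ j S, N.thread j = some S → S.hub ∉ N.todo
  thread_inj : ∀ j j' S S', N.thread j = some S → N.thread j' = some S' → S.hub = S'.hub → j = j'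
  thread_label : ∀ j S, N.thread j = some S → ∀ l ∈ N.labels, l.2.1 = S.hub → S.Settled l.1

/-- Common form of all steps that pop a vertex, in PLaNT and in DGLL: at most one label appears, and
it belongs to the popped vertex and the root of the thread. -/
theorem Valid.pop {N N' : NodeState V p} (hN : N.Valid W R q i switch) {j : Fin p}
    {S S' : Search V} {x : V} (hj : N.thread j = some S) (hx : x ∈ S.queue)
    (htodo : N'.todo = N.todo) (hthread : N'.thread = Function.update N.thread j (some S'))
    (hlab : ∀ l ∈ N'.labels, l ∈ N.labels ∨ l = (x, S.hub, S.dist x) ∧ LowReach W R S.hub x)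
    (hhub : S'.hub = S.hub) (hvalid : S'.Valid W R)
    (hanc : switch ≤ R.treeId S.hub → ∀ y, S'.anc y = y) (hxS : S'.Settled x)
    (hyS : ∀ y, S.Settled y → S'.Settled y) : N'.Valid W R q i switch := by
  have key : ∀ k T, N'.thread k = some T →
      (k = j ∧ T = S') ∨ (k ≠ j ∧ N.thread k = some T) := by
    intro k T hk
    rw [hthread] at hk
    by_cases h : k = j
    · subst h
      simp only [Function.update_self, Option.some.injEq] at hk
      exact Or.inl ⟨rfl, hk.symm⟩
    · rw [Function.update_of_ne h] at hk
      exact Or.inr ⟨h, hk⟩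
  refine ⟨?_, ?_, ?_, ?_, ?_, ?_, ?_, ?_, ?_, ?_, ?_⟩
  · rw [htodo]; exact hN.todo_owned
  · intro l hl
    rcases hlab l hl with h | ⟨rfl, -⟩
    · exact hN.label_owned l h
    · exact hN.thread_owned j S hj
  · intro l hl
    rcases hlab l hl with h | ⟨rfl, h⟩
    · exact hN.label_reach l h
    · exact h
  · intro l hl
    rw [htodo]
    rcases hlab l hl with h | ⟨rfl, -⟩
    · exact hN.label_todo l h
    · exact hN.thread_todo j S hj
  -- A vertex already labelled with this hub is settled, hence not in the queue, whereas `x` was.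
  · have new : ∀ l ∈ N.labels, l.1 = x → l.2.1 = S.hub → False := by
      rintro l hl rfl h2
      exact (hN.thread_label j S hj l hl h2).1 hx
    intro l hl l' hl' h1 h2
    rcases hlab l hl with h | ⟨rfl, -⟩ <;> rcases hlab l' hl' with h' | ⟨rfl, -⟩
    · exact hN.label_inj l h l' h' h1 h2
    · exact (new l h h1 h2).elim
    · exact (new l' h' h1.symm h2.symm).elim
    · rfl
  · intro k T hk
    rcases key k T hk with ⟨rfl, rfl⟩ | ⟨-, h⟩
    · exact hvalid
    · exact hN.thread_valid k T h
  · intro k T hk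
    rcases key k T hk with ⟨rfl, rfl⟩ | ⟨-, h⟩
    · rw [hhub]; exact hanc
    · exact hN.thread_anc k T h
  · intro k T hk
    rcases key k T hk with ⟨rfl, rfl⟩ | ⟨-, h⟩
    · rw [hhub]; exact hN.thread_owned k S hj
    · exact hN.thread_owned k T h
  · intro k T hk
    rw [htodo]
    rcases key k T hk with ⟨rfl, rfl⟩ | ⟨-, h⟩
    · rw [hhub]; exact hN.thread_todo k S hj
    · exact hN.thread_todo k T h
  · intro k k' T T' hk hk' hTT
    rcases key k T hk with ⟨rfl, rfl⟩ | ⟨h1, h⟩ <;> rcases key k' T' hk' with ⟨rfl, rfl⟩ | ⟨h1', h'⟩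
    · rfl
    · exact hN.thread_inj _ _ _ _ hj h' (hhub.symm.trans hTT)
    · exact hN.thread_inj _ _ _ _ h hj (hTT.trans hhub)
    · exact hN.thread_inj _ _ _ _ h h' hTT
  · intro k T hk l hl hlT
    rcases key k T hk with ⟨rfl, rfl⟩ | ⟨hkj, h⟩ <;> rcases hlab l hl with h' | ⟨rfl, -⟩
    · exact hyS _ (hN.thread_label k S hj l h' (hlT.trans hhub))
    · exact hxS
    · exact hN.thread_label k T h l h' hlT
    · exact (hkj (hN.thread_inj _ _ _ _ h hj hlT.symm)).elim

/-- Serves for finished trees and for cleaning. Moving a label from the local to the global table is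
invisible to `labels`, which is the union of both. -/
theorem Valid.shrink {N N' : NodeState V p} (hN : N.Valid W R q i switch)
    (htodo : N'.todo = N.todo) (hthread : ∀ j S, N'.thread j = some S → N.thread j = some S)
    (hlab : N'.labels ⊆ N.labels) : N'.Valid W R q i switch where
  todo_owned := by rw [htodo]; exact hN.todo_owned
  label_owned l hl := hN.label_owned l (hlab hl)
  label_reach l hl := hN.label_reach l (hlab hl)
  label_todo l hl := by rw [htodo]; exact hN.label_todo l (hlab hl)
  label_inj l hl l' hl' := hN.label_inj l (hlab hl) l' (hlab hl')
  thread_valid j S h := hN.thread_valid j S (hthread j S h)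
  thread_anc j S h := hN.thread_anc j S (hthread j S h)
  thread_owned j S h := hN.thread_owned j S (hthread j S h)
  thread_todo j S h := by rw [htodo]; exact hN.thread_todo j S (hthread j S h)
  thread_inj j j' S S' h h' := hN.thread_inj j j' S S' (hthread j S h) (hthread j' S' h')
  thread_label j S h l hl := hN.thread_label j S (hthread j S h) l (hlab hl)

theorem Valid.exit {N : NodeState V p} (hN : N.Valid W R q i switch) (j : Fin p) :
    (N.setThread j none).Valid W R q i switch := by
  refine hN.shrink rfl (fun k S h => ?_) (Finset.Subset.refl _)
  by_cases hk : k = j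
  · subst hk; simp [setThread] at h
  · simpa [setThread, Function.update_of_ne hk] using h

theorem Valid.card_labelsOf_le {N : NodeState V p} (hN : N.Valid W R q i switch) (x : V) :
    (N.labelsOf x).card ≤ Fintype.card V := by
  classical
  rw [← Finset.card_univ]
  refine Finset.card_le_card_of_injOn (fun a => a.1) (fun _ _ => Finset.mem_univ _) ?_
  intro a ha b hb hab
  simp only [labelsOf, Finset.coe_image, Set.mem_image, Finset.mem_coe, Finset.mem_filter]
    at ha hb
  obtain ⟨l, ⟨hl, hlx⟩, rfl⟩ := ha
  obtain ⟨l', ⟨hl', hlx'⟩, rfl⟩ := hb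
  rw [hN.label_inj l hl l' hl' (hlx.trans hlx'.symm) hab]

/-- A root still in the task queue has no label and no running thread, so its tree starts with a
clean slate; erasing it ensures that this happens only once. -/
theorem Valid.start {N : NodeState V p} (hN : N.Valid W R q i switch) {j : Fin p} {h : V}
    (hh : h ∈ N.todo) :
    ({ N with todo := N.todo.erase h }.setThread j
      (some (Search.start h (N.labelsOf h)))).Valid W R q i switch := by
  have key : ∀ k T, ({ N with todo := N.todo.erase h }.setThread j
      (some (Search.start h (N.labelsOf h)))).thread k = some T →
      (k = j ∧ T = Search.start h (N.labelsOf h)) ∨ (k ≠ j ∧ N.thread k = some T) := by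
    intro k T hk
    by_cases h : k = j
    · subst h
      simp only [setThread, Function.update_self, Option.some.injEq] at hk
      exact Or.inl ⟨rfl, hk.symm⟩
    · simp only [setThread, Function.update_of_ne h] at hk
      exact Or.inr ⟨h, hk⟩
  refine ⟨fun x hx => hN.todo_owned x (Finset.mem_of_mem_erase hx), hN.label_owned,
    hN.label_reach, fun l hl hx => hN.label_todo l hl (Finset.mem_of_mem_erase hx),
    hN.label_inj, ?_, ?_, ?_, ?_, ?_, ?_⟩
  · intro k T hk
    rcases key k T hk with ⟨rfl, rfl⟩ | ⟨-, h⟩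
    · exact Search.Valid.start (hN.card_labelsOf_le h)
    · exact hN.thread_valid k T h
  · intro k T hk
    rcases key k T hk with ⟨rfl, rfl⟩ | ⟨-, h⟩
    · exact fun _ _ => rfl
    · exact hN.thread_anc k T h
  · intro k T hk
    rcases key k T hk with ⟨rfl, rfl⟩ | ⟨-, h'⟩
    · exact hN.todo_owned h hh
    · exact hN.thread_owned k T h'
  · intro k T hk
    rcases key k T hk with ⟨rfl, rfl⟩ | ⟨-, h'⟩
    · simp [setThread, Search.start]
    · exact fun hx => hN.thread_todo k T h' (Finset.mem_of_mem_erase hx)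
  · intro k k' T T' hk hk' hTT
    rcases key k T hk with ⟨rfl, rfl⟩ | ⟨h1, h⟩ <;> rcases key k' T' hk' with ⟨rfl, rfl⟩ | ⟨h1', h'⟩
    · rfl
    · exact (hN.thread_todo k' T' h' (hTT ▸ hh)).elim
    · exact (hN.thread_todo k T h (hTT ▸ hh)).elim
    · exact hN.thread_inj _ _ _ _ h h' hTT
  · intro k T hk l hl hlT
    rcases key k T hk with ⟨rfl, rfl⟩ | ⟨hkj, h'⟩
    · exact (hN.label_todo l hl (hlT ▸ hh)).elim
    · exact hN.thread_label k T h' l hl hlT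

theorem Valid.step {N N' : NodeState V p} {limit : ℕ} (hN : N.Valid W R q i switch)
    (h : Step W R switch limit N N') : N'.Valid W R q i switch := by
  have labels_insert : ∀ (N₀ : NodeState V p) (x h : V) (d : WithTop ℝ) (l : Label V),
      (l ∈ insert (x, h, d) N₀.globalTable ∪ N₀.localTable ∨
        l ∈ N₀.globalTable ∪ insert (x, h, d) N₀.localTable) →
      l ∈ N₀.labels ∨ l = (x, h, d) := by
    intro N₀ x h d l hl
    simp only [labels, Finset.mem_union, Finset.mem_insert] at hl ⊢
    tauto
  cases h with
  | start j h hj hh hmax hlim => exact hN.start hh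
  | plantLabel j S x hj hs hact hmin hr =>
    have hS := hN.thread_valid j S hj
    refine hN.pop (S' := S.relaxAnc W R x) hj hmin.1 rfl rfl (fun l hl => ?_) rfl
      (hS.relaxAnc hmin) (fun h => absurd hs (not_lt.mpr h)) hmin.settled_relax
      (fun y hy => Search.Settled.relax hy hmin)
    exact (labels_insert N _ _ _ l (Or.inl hl)).imp_right
      fun h => ⟨h, hS.reach x (hS.queue_ne_top x hmin.1) hr⟩
  | plantExplore j S x hj hs hact hmin hr =>
    exact hN.pop (S' := S.relaxAnc W R x) hj hmin.1 rfl rfl (fun l hl => Or.inl hl) rfl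
      ((hN.thread_valid j S hj).relaxAnc hmin) (fun h => absurd hs (not_lt.mpr h))
      hmin.settled_relax (fun y hy => Search.Settled.relax hy hmin)
  | plantSkip j S x hj hs hact hmin hr =>
    exact hN.pop (S' := S.drop x) hj hmin.1 rfl rfl (fun l hl => Or.inl hl) rfl
      (hN.thread_valid j S hj).drop (fun h => absurd hs (not_lt.mpr h))
      hmin.settled_drop (fun y hy => hy.drop)
  | plantExit j S hj hs hact => exact hN.exit j
  | dgllPrune j S x hj hs hmin hpr =>
    exact hN.pop (S' := S.drop x) hj hmin.1 rfl rfl (fun l hl => Or.inl hl) rfl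
      (hN.thread_valid j S hj).drop (hN.thread_anc j S hj)
      hmin.settled_drop (fun y hy => hy.drop)
  | dgllLabel j S x hj hs hmin hpr =>
    have hS := hN.thread_valid j S hj
    have hanc := hN.thread_anc j S hj hs
    have hr : R.rank x ≤ R.rank S.hub := not_lt.mp fun h => hpr (Or.inl h)
    refine hN.pop (S' := S.relax W x) hj hmin.1 rfl rfl (fun l hl => ?_) rfl
      (hS.relax hanc hmin hr) (hN.thread_anc j S hj) hmin.settled_relax
      (fun y hy => Search.Settled.relax hy hmin)
    refine (labels_insert N _ _ _ l (Or.inr hl)).imp_right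
      fun h => ⟨h, hS.reach x (hS.queue_ne_top x hmin.1) ?_⟩
    rw [hanc, R.rank_higher]
    simpa using hr
  | dgllExit j S hj hs hq => exact hN.exit j

/-- The number of labels is bounded by the number of pairs of an owned hub and a vertex that the
hub reaches. -/
theorem Valid.card_labels_le {N : NodeState V p} (hN : N.Valid W R q i switch)
    (A : V → Finset V) (hA : ∀ h x, LowReach W R h x → x ∈ A h) :
    N.labels.card ≤ ∑ h with R.rank h % q = i, (A h).card := by
  classical
  rw [← Finset.card_sigma]
  refine Finset.card_le_card_of_injOn (fun l => ⟨l.2.1, l.1⟩) (fun l hl => ?_) ?_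
  · simp only [Finset.coe_sigma, Set.mem_sigma_iff, Finset.mem_coe, Finset.mem_filter,
      Finset.mem_univ, true_and]
    exact ⟨hN.label_owned l hl, hA _ _ (hN.label_reach l hl)⟩
  · intro l hl l' hl' h
    simp only [Sigma.mk.injEq, heq_eq_eq] at h
    exact hN.label_inj l hl l' hl' h.2 h.1

end NodeState

/-! ### Executions of the cluster, and memory other than labels. -/

namespace Cluster

variable [DecidableEq V] {p q : ℕ} {W : WeightedGraph V} {R : Ranking V} {P : Schedule}

theorem Occurs.valid {K : Cluster V q p} (h : K.Occurs W R P) :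
    (∀ i, (K.node i).Valid W R q i P.switch) ∧ K.packet.card ≤ Fintype.card V := by
  classical
  induction h with
  | refl =>
    refine ⟨fun i => ?_, by simp [initial]⟩
    constructor <;> simp [initial, NodeState.labels, Ranking.taskQueue]
  | tail _ hstep ih =>
    obtain ⟨hv, hp⟩ := ih
    cases hstep with
    | compute i N hc hs =>
      refine ⟨fun k => ?_, hp⟩
      by_cases hk : k = i
      · subst hk
        simpa using (hv k).step hs
      · simpa [Function.update_of_ne hk] using hv k
    | synchronize _ _ _ => exact ⟨hv, hp⟩
    | broadcast A _ _ _ hA => exact ⟨hv, hA⟩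
    | reduce _ =>
      refine ⟨fun i => (hv i).shrink rfl (fun _ _ h => h) fun l hl => ?_, by simp⟩
      simp only [NodeState.labels, cleanNode, Finset.mem_union, Finset.mem_filter,
        Finset.mem_inter, Finset.mem_sdiff] at hl ⊢
      tauto
    | advance _ _ _ => exact ⟨hv, hp⟩

theorem graphWords_eq (W : WeightedGraph V) :
    graphWords W = Fintype.card V + 4 * W.graph.edgeSet.ncard := by
  classical
  have h := W.graph.sum_degrees_eq_twice_card_edges
  have h1 : ∀ x, (W.graph.neighborSet x).ncard = W.graph.degree x := fun x => by
    rw [Set.ncard_eq_toFinset_card', ← SimpleGraph.card_neighborFinset_eq_degree]; rfl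
  have h2 : W.graph.edgeSet.ncard = W.graph.edgeFinset.card := by
    rw [Set.ncard_eq_toFinset_card']; rfl
  simp only [graphWords, h1, Finset.sum_add_distrib, ← Finset.mul_sum, h, h2]
  simp
  ring

/-- Everything but the label tables takes `O(n + m)` words. -/
theorem Occurs.nodeMemory_le {K : Cluster V q p} (h : K.Occurs W R P) [Nonempty V] (i : Fin q) :
    K.nodeMemory W i ≤ 4 * (K.node i).labels.card + (12 + 6 * p) * Fintype.card V
      + 2 * p + 4 * W.graph.edgeSet.ncard := by
  classical
  obtain ⟨hv, hp⟩ := h.valid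
  have hn : 0 < Fintype.card V := Fintype.card_pos
  have h1 : (K.node i).globalTable.card ≤ (K.node i).labels.card :=
    Finset.card_le_card Finset.subset_union_left
  have h2 : (K.node i).localTable.card ≤ (K.node i).labels.card :=
    Finset.card_le_card Finset.subset_union_right
  have h3 : (K.node i).todo.card ≤ Fintype.card V := Finset.card_le_univ _
  -- Two arrays, the queue and the hashed root labels take at most `2 * n` words each for the pair
  -- of arrays, the queue and the hash.
  have h4 : ∑ j, threadWords ((K.node i).thread j) ≤ p * (6 * Fintype.card V + 2) := by
    refine (Finset.sum_le_card_nsmul _ _ (6 * Fintype.card V + 2) fun j _ => ?_).trans (by simp)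
    cases hj : (K.node i).thread j with
    | none => simp only [threadWords]; omega
    | some S =>
      have := ((hv i).thread_valid j S hj).hash_card
      have := S.queue.card_le_univ
      simp only [threadWords]; omega
  rw [nodeMemory, graphWords_eq]
  nlinarith

end Cluster

end Invariants

/-! ### Components of vertex sets in a tree -/

section Component

variable {ι : Type v} {T : SimpleGraph ι} {A B : Set ι} {r s t : ι}

/-- The vertices that can be reached from `t` inside `A`. -/
def component (T : SimpleGraph ι) (A : Set ι) (t : ι) : Set ι :=
  {s | ∃ p : T.Walk t s, ∀ x ∈ p.support, x ∈ A}

theorem mem_component_self (h : t ∈ A) : t ∈ component T A t :=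
  ⟨SimpleGraph.Walk.nil, by simpa using h⟩

theorem component_subset : component T A t ⊆ A := fun _ ⟨p, hp⟩ => hp _ p.end_mem_support

theorem mem_component_symm (h : s ∈ component T A t) : t ∈ component T A s := by
  obtain ⟨p, hp⟩ := h
  exact ⟨p.reverse, fun x hx => hp x (by simpa using hx)⟩

theorem mem_component_trans (h : s ∈ component T A t) (h' : r ∈ component T A s) :
    r ∈ component T A t := by
  obtain ⟨p, hp⟩ := h
  obtain ⟨p', hp'⟩ := h'
  refine ⟨p.append p', fun x hx => ?_⟩
  rcases (SimpleGraph.Walk.mem_support_append_iff _ _).mp hx with hx | hx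
  exacts [hp x hx, hp' x hx]

theorem component_eq (h : s ∈ component T A t) : component T A s = component T A t :=
  Set.Subset.antisymm (fun _ hr => mem_component_trans h hr)
    fun _ hr => mem_component_trans (mem_component_symm h) hr

theorem component_mono (h : A ⊆ B) : component T A t ⊆ component T B t :=
  fun _ ⟨p, hp⟩ => ⟨p, fun x hx => h (hp x hx)⟩

theorem subset_component (hB : ∀ s ∈ B, s ∈ component T B t) (h : B ⊆ A) :
    B ⊆ component T A t := fun s hs => component_mono h (hB s hs)

theorem component_component (h : s ∈ component T A t) :
    s ∈ component T (component T A t) t := by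
  classical
  obtain ⟨p, hp⟩ := h
  refine ⟨p, fun x hx => ⟨p.takeUntil x hx, fun y hy => hp y ?_⟩⟩
  exact p.support_takeUntil_subset_support hx hy

theorem component_component' (hr : r ∈ component T A t) (hs : s ∈ component T A t) :
    s ∈ component T (component T A t) r :=
  mem_component_trans (mem_component_symm (component_component hr)) (component_component hs)

/-- The components left by the two ends of an edge of a tree, each taken on the side of the other
end, do not meet. -/
theorem not_mem_component_of_adj (hT : T.IsAcyclic) (hadj : T.Adj t r)
    (hs : s ∈ component T (A \ {t}) r) (hs' : s ∈ component T (B \ {r}) t) : False := by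
  obtain ⟨p, hp⟩ := hs
  obtain ⟨p', hp'⟩ := hs'
  have hb := SimpleGraph.isAcyclic_iff_forall_adj_isBridge.mp hT hadj
  rw [SimpleGraph.isBridge_iff_forall_walk_mem_edges] at hb
  have hmem := hb (p'.append p.reverse)
  rw [SimpleGraph.Walk.edges_append, List.mem_append, SimpleGraph.Walk.edges_reverse,
    List.mem_reverse] at hmem
  rcases hmem with hmem | hmem
  · exact (hp' r (SimpleGraph.Walk.snd_mem_support_of_mem_edges _ hmem)).2 rfl
  · exact (hp t (SimpleGraph.Walk.fst_mem_support_of_mem_edges _ hmem)).2 rfl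

/-- The first edge of a path from `t` to `s` gives `r`; a path does not return to `t`. -/
theorem exists_adj_mem_component (ht : s ∈ component T A t) (hst : s ≠ t) :
    ∃ r, T.Adj t r ∧ r ∈ component T (A \ {t}) s := by
  classical
  obtain ⟨p, hp⟩ := ht
  have hpath := p.bypass_isPath
  have hsub := p.support_bypass_subset_support
  generalize p.bypass = p' at hpath hsub
  cases p' with
  | nil => exact (hst rfl).elim
  | cons hadj w =>
    rename_i r
    rw [SimpleGraph.Walk.cons_isPath_iff] at hpath
    refine ⟨r, hadj, mem_component_symm ⟨w, fun x hx => ⟨hp x (hsub (by simp [hx])), ?_⟩⟩⟩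
    rintro rfl
    exact hpath.2 hx

end Component

namespace RelaxedTreeDecomposition

variable {V : Type u} {G : SimpleGraph V} {ι : Type v} {c : ℕ}
  {D : RelaxedTreeDecomposition G ι c} {dep : ι → ℕ}

theorem part_eq_component (D : RelaxedTreeDecomposition G ι c) (dep : ι → ℕ) (t : ι) :
    D.part dep t = component D.tree {x | dep t ≤ dep x} t := rfl

theorem population_mono {K L : Set ι} (h : K ⊆ L) : D.population K ⊆ D.population L :=
  fun _ hx t ht => h (hx t ht)

theorem not_disjoint_of_mem_population {K L : Set ι} {x : V} (h : x ∈ D.population K)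
    (h' : x ∈ D.population L) : ∃ t, t ∈ K ∧ t ∈ L :=
  let ⟨t, ht⟩ := D.vertex_mem x
  ⟨t, h t ht, h' t ht⟩

/-- The bags that contain a vertex are connected inside every set of bags that contains them. -/
theorem mem_component_of_mem_bag {A : Set ι} {x : V} {s t : ι} (hA : ∀ r, x ∈ D.bag r → r ∈ A)
    (ht : x ∈ D.bag t) (hs : x ∈ D.bag s) : s ∈ component D.tree A t := by
  obtain ⟨w⟩ := (D.connected x).preconnected ⟨t, ht⟩ ⟨s, hs⟩
  let f := (SimpleGraph.Embedding.induce (G := D.tree) {t | x ∈ D.bag t}).toHom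
  refine ⟨w.map f, fun r hr => ?_⟩
  have hr' : r ∈ (w.map f).support := hr
  rw [SimpleGraph.Walk.support_map, List.mem_map] at hr'
  obtain ⟨r', -, rfl⟩ := hr'
  exact hA _ r'.2

/-! ### Existence of centroid decompositions -/

/-- Otherwise every bag `t` of `K` leaves a component with more than half of the population. Take
`t` whose heavy component has the fewest bags and move to the neighbour `r` of `t` in it: the heavy
component of `r` turns out to be strictly smaller. -/
theorem exists_centroid [Finite V] [Finite ι] (D : RelaxedTreeDecomposition G ι c) {K : Set ι}
    (hne : K.Nonempty) (hK : ∀ t ∈ K, ∀ s ∈ K, s ∈ component D.tree K t) :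
    ∃ t ∈ K, ∀ s ∈ K, s ≠ t →
      2 * (D.population (component D.tree (K \ {t}) s)).ncard ≤ (D.population K).ncard := by
  classical
  by_contra! hcon
  choose! g hgK hgt hg using hcon
  obtain ⟨t, htK, hmin⟩ := Set.exists_min_image K
    (fun t => (component D.tree (K \ {t}) (g t)).ncard) K.toFinite hne
  obtain ⟨r, hadj, hr⟩ := exists_adj_mem_component (hK t htK (g t) (hgK t htK)) (hgt t htK)
  have hrK : r ∈ K := (component_subset hr).1
  refine absurd (hmin r hrK) (not_le.mpr (Set.ncard_lt_ncard ?_ (Set.toFinite _)))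
  have hsub : ∀ t s, component D.tree (K \ {t}) s ⊆ K :=
    fun t s => component_subset.trans Set.sdiff_subset
  -- Two vertex sets, each larger than half of the population, share a vertex, so the two heavy
  -- components share a bag `z`.
  obtain ⟨x, hx, hx'⟩ : (D.population (component D.tree (K \ {t}) (g t)) ∩
      D.population (component D.tree (K \ {r}) (g r))).Nonempty := by
    rw [← Set.ncard_pos (Set.toFinite _)]
    have h1 := Set.ncard_union_add_ncard_inter
      (D.population (component D.tree (K \ {t}) (g t)))
      (D.population (component D.tree (K \ {r}) (g r)))
    have h2 : (D.population (component D.tree (K \ {t}) (g t)) ∪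
        D.population (component D.tree (K \ {r}) (g r))).ncard ≤ (D.population K).ncard :=
      Set.ncard_le_ncard (Set.union_subset (population_mono (hsub _ _))
        (population_mono (hsub _ _))) (Set.toFinite _)
    have h3 := hg t htK
    have h4 := hg r hrK
    omega
  obtain ⟨z, hz, hz'⟩ := not_disjoint_of_mem_population hx hx'
  have hzr : z ∈ component D.tree (K \ {t}) r := mem_component_trans (mem_component_symm hr) hz
  -- Otherwise `z` would be joined to `r` avoiding `t` and to `t` avoiding `r`, although the edge
  -- between them is a bridge.
  have ht' : t ∉ component D.tree (K \ {r}) (g r) := fun h =>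
    not_mem_component_of_adj D.isTree.isAcyclic hadj hzr
      (mem_component_trans (mem_component_symm h) hz')
  refine ⟨?_, fun h => (component_subset (h hr)).2 rfl⟩
  rw [← component_eq hz, ← component_eq hz']
  refine subset_component (fun s hs => ?_) fun s hs => ⟨?_, ?_⟩
  · rw [component_eq hz'] at hs ⊢
    exact component_component' hz' hs
  · exact (component_subset hs).1
  · rintro rfl
    rw [component_eq hz'] at hs
    exact ht' hs

/-- The bag that is removed from the component `K`. -/
def removedBag [Finite V] [Finite ι] (D : RelaxedTreeDecomposition G ι c) (K : Set ι) : ι :=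
  open scoped Classical in
  if h : D.root ∉ K ∧ K.Nonempty ∧ ∀ t ∈ K, ∀ s ∈ K, s ∈ component D.tree K t then
    (D.exists_centroid h.2.1 h.2.2).choose
  else D.root

/-- The bags that are left before round `d`. -/
def remaining [Finite V] [Finite ι] (D : RelaxedTreeDecomposition G ι c) : ℕ → Set ι
  | 0 => Set.univ
  | d + 1 => {t ∈ D.remaining d | D.removedBag (component D.tree (D.remaining d) t) ≠ t}

section

variable [Finite V] [Finite ι]

theorem removedBag_mem {A : Set ι} {t : ι} (ht : t ∈ A) :
    D.removedBag (component D.tree A t) ∈ component D.tree A t := by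
  unfold removedBag
  split_ifs with h
  · exact (D.exists_centroid h.2.1 h.2.2).choose_spec.1
  -- A component is nonempty and connected, so the default `D.root` is taken only when the root
  -- belongs to it.
  · by_contra hr
    exact h ⟨hr, ⟨t, mem_component_self ht⟩, fun s hs s' hs' => component_component' hs hs'⟩

theorem removedBag_eq_root {K : Set ι} (h : D.root ∈ K) : D.removedBag K = D.root :=
  dif_neg fun h' => h'.1 h

theorem removedBag_centroid {A : Set ι} {s t : ι} (ht : t ∈ A)
    (hr : D.removedBag (component D.tree A t) ≠ D.root) (hs : s ∈ component D.tree A t)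
    (hst : s ≠ D.removedBag (component D.tree A t)) :
    2 * (D.population (component D.tree
      (component D.tree A t \ {D.removedBag (component D.tree A t)}) s)).ncard ≤
      (D.population (component D.tree A t)).ncard := by
  have h : D.root ∉ component D.tree A t ∧ (component D.tree A t).Nonempty ∧
      ∀ t' ∈ component D.tree A t, ∀ s ∈ component D.tree A t,
        s ∈ component D.tree (component D.tree A t) t' :=
    ⟨fun h => hr (removedBag_eq_root h), ⟨t, mem_component_self ht⟩,
      fun s hs s' hs' => component_component' hs hs'⟩
  unfold removedBag at hst ⊢
  rw [dif_pos h] at hst ⊢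
  exact (D.exists_centroid h.2.1 h.2.2).choose_spec.2 s hs hst

theorem remaining_antitone (D : RelaxedTreeDecomposition G ι c) : Antitone D.remaining :=
  antitone_nat_of_succ_le fun _ _ h => h.1

theorem exists_not_mem_remaining (D : RelaxedTreeDecomposition G ι c) (t : ι) :
    ∃ d, t ∉ D.remaining d := by
  by_contra! hcon
  have hlt : ∀ d, (D.remaining (d + 1)).ncard < (D.remaining d).ncard := fun d => by
    refine Set.ncard_lt_ncard ⟨fun _ h => h.1, fun h => ?_⟩ (Set.toFinite _)
    have hmem := removedBag_mem (D := D) (hcon d)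
    have := (h (component_subset hmem)).2
    rw [component_eq hmem] at this
    exact this rfl
  have : ∀ d, (D.remaining d).ncard + d ≤ (D.remaining 0).ncard := fun d => by
    induction d with
    | zero => simp
    | succ d ih => have := hlt d; omega
  have := this ((D.remaining 0).ncard + 1)
  omega

open scoped Classical in
/-- The round in which a bag is removed. -/
def removalDepth (D : RelaxedTreeDecomposition G ι c) (t : ι) : ℕ :=
  Nat.find (D.exists_not_mem_remaining t) - 1

theorem mem_remaining_iff {t : ι} {d : ℕ} : t ∈ D.remaining d ↔ d ≤ D.removalDepth t := by
  classical
  -- All bags are present before round 0, so the subtraction in `removalDepth` is not truncated.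
  have h0 : Nat.find (D.exists_not_mem_remaining t) ≠ 0 := fun h => by
    have := Nat.find_spec (D.exists_not_mem_remaining t)
    rw [h] at this
    exact this (Set.mem_univ t)
  constructor
  · intro h
    by_contra hlt
    refine Nat.find_spec (D.exists_not_mem_remaining t) (D.remaining_antitone ?_ h)
    unfold removalDepth at hlt
    omega
  · intro h
    by_contra hn
    have := Nat.find_min' (D.exists_not_mem_remaining t) hn
    unfold removalDepth at h
    omega

theorem remaining_removalDepth (D : RelaxedTreeDecomposition G ι c) (d : ℕ) :
    {x | d ≤ D.removalDepth x} = D.remaining d := Set.ext fun _ => mem_remaining_iff.symm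

theorem removedBag_removalDepth (t : ι) :
    D.removedBag (component D.tree (D.remaining (D.removalDepth t)) t) = t := by
  by_contra h
  have : t ∈ D.remaining (D.removalDepth t + 1) := ⟨mem_remaining_iff.mpr le_rfl, h⟩
  exact absurd (mem_remaining_iff.mp this) (by omega)

theorem isCentroidDepth_removalDepth (D : RelaxedTreeDecomposition G ι c) :
    D.IsCentroidDepth D.removalDepth := by
  have hpart : ∀ t, D.part D.removalDepth t =
      component D.tree (D.remaining (D.removalDepth t)) t := fun t => by
    rw [part_eq_component, remaining_removalDepth]
  refine ⟨?_, fun t s hs hd => ?_, fun t d hd => ?_, fun t s ht hs hd => ?_⟩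
  · by_contra h
    have hroot : D.root ∈ D.remaining 1 := mem_remaining_iff.mpr (by omega)
    exact hroot.2 (removedBag_eq_root (mem_component_self (Set.mem_univ _)))
  · rw [hpart] at hs
    rw [← removedBag_removalDepth (D := D) t, ← removedBag_removalDepth (D := D) s, hd,
      component_eq hs]
  · have ht : t ∈ D.remaining d := mem_remaining_iff.mpr hd
    have hmem := removedBag_mem ht (D := D)
    set s := D.removedBag (component D.tree (D.remaining d) t) with hs
    have hsd : D.removalDepth s = d := by
      refine le_antisymm ?_ (mem_remaining_iff.mp (component_subset hmem))
      by_contra hlt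
      have h' : s ∈ D.remaining (d + 1) := mem_remaining_iff.mpr (by omega)
      refine h'.2 ?_
      rw [component_eq hmem]
    refine ⟨s, hsd, ?_⟩
    rw [hpart, hsd]
    exact mem_component_symm hmem
  · have htA : t ∈ D.remaining (D.removalDepth t) := mem_remaining_iff.mpr le_rfl
    have hrem := removedBag_removalDepth (D := D) t
    rw [hpart] at hs
    have hst : s ≠ t := by rintro rfl; omega
    have := removedBag_centroid htA (by rwa [hrem]) hs (by rwa [hrem])
    rw [hrem] at this
    rw [hpart, hpart, hd]
    refine le_trans (Nat.mul_le_mul_left 2 (Set.ncard_le_ncard (population_mono ?_)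
      (Set.toFinite _))) this
    have hsA : s ∈ D.remaining (D.removalDepth t + 1) := mem_remaining_iff.mpr hd.ge
    refine subset_component (fun r hr => component_component' (mem_component_self hsA) hr)
      fun r hr => ⟨?_, ?_⟩
    · rw [← component_eq hs]
      exact component_mono (fun _ h => h.1) hr
    · rintro rfl
      exact (component_subset hr).2 hrem

end

/-! ### Bags of minimum depth -/

theorem exists_bag_level (D : RelaxedTreeDecomposition G ι c) (dep : ι → ℕ) (x : V) :
    ∃ t, x ∈ D.bag t ∧ dep t = D.level dep x :=
  Nat.sInf_mem (s := {d | ∃ t, x ∈ D.bag t ∧ dep t = d})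
    (let ⟨t, ht⟩ := D.vertex_mem x; ⟨dep t, t, ht, rfl⟩)

/-- A bag of minimum depth among those that contain `x`. -/
def minBag (D : RelaxedTreeDecomposition G ι c) (dep : ι → ℕ) (x : V) : ι :=
  (D.exists_bag_level dep x).choose

theorem mem_bag_minBag (x : V) : x ∈ D.bag (D.minBag dep x) :=
  (D.exists_bag_level dep x).choose_spec.1

theorem dep_minBag (D : RelaxedTreeDecomposition G ι c) (dep : ι → ℕ) (x : V) :
    dep (D.minBag dep x) = D.level dep x :=
  (D.exists_bag_level dep x).choose_spec.2

theorem level_le {x : V} {t : ι} (h : x ∈ D.bag t) : D.level dep x ≤ dep t :=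
  Nat.sInf_le ⟨t, h, rfl⟩

/-- The vertices that remain in the component of the minimum-depth bag of `h` when that bag is
removed. -/
def reachSet (D : RelaxedTreeDecomposition G ι c) (dep : ι → ℕ) (h : V) : Set V :=
  D.population (D.part dep (D.minBag dep h))

/-- No bag of `x` is removed before the minimum-depth bag of `h`, so the connected set of bags
containing `x` lies in a single component at that time. -/
theorem mem_reachSet_of_mem_bag {h x : V} {t : ι} (hx : D.level dep h ≤ D.level dep x)
    (ht : t ∈ D.part dep (D.minBag dep h)) (hxt : x ∈ D.bag t) : x ∈ D.reachSet dep h := by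
  intro s hs
  rw [part_eq_component] at ht ⊢
  refine mem_component_trans ht (mem_component_of_mem_bag (fun r hr => ?_) hxt hs)
  change dep (D.minBag dep h) ≤ dep r
  rw [D.dep_minBag dep]
  exact hx.trans (level_le hr)

theorem self_mem_reachSet (h : V) : h ∈ D.reachSet dep h :=
  mem_reachSet_of_mem_bag le_rfl (mem_component_self (le_refl (dep (D.minBag dep h))))
    (mem_bag_minBag h)

theorem mem_reachSet_of_adj {h x y : V} (hx : x ∈ D.reachSet dep h) (hxy : G.Adj x y)
    (hy : D.level dep h ≤ D.level dep y) : y ∈ D.reachSet dep h :=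
  let ⟨t, hxt, hyt⟩ := D.edge_mem x y hxy
  mem_reachSet_of_mem_bag hy (hx t hxt) hyt

theorem IsCentroidDepth.eq_of_mem_part (hd : D.IsCentroidDepth dep) {r s t : ι}
    (h : dep s = dep t) (hs : r ∈ D.part dep s) (ht : r ∈ D.part dep t) : s = t := by
  refine hd.at_most_one t s ?_ h
  rw [part_eq_component] at hs ht ⊢
  rw [h] at hs
  exact mem_component_trans ht (mem_component_symm hs)

/-- The hubs of level `d` of a vertex `x` all lie in one bag. -/
theorem IsCentroidDepth.ncard_hubs_le (hd : D.IsCentroidDepth dep) (d : ℕ) (x : V) :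
    {h | D.level dep h = d ∧ x ∈ D.reachSet dep h}.ncard ≤ if d = 0 then D.rootWidth else c := by
  classical
  rcases Set.eq_empty_or_nonempty {h | D.level dep h = d ∧ x ∈ D.reachSet dep h} with h0 | ⟨h, hh⟩
  · rw [h0]; simp
  have hsub : {h | D.level dep h = d ∧ x ∈ D.reachSet dep h} ⊆ D.bag (D.minBag dep h) := by
    intro h' hh'
    obtain ⟨r, hr, hr'⟩ := not_disjoint_of_mem_population hh.2 hh'.2
    rw [hd.eq_of_mem_part (by rw [D.dep_minBag dep, D.dep_minBag dep, hh.1, hh'.1]) hr hr']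
    exact mem_bag_minBag h'
  refine (Set.ncard_le_ncard hsub (Finset.finite_toSet _)).trans ?_
  rw [Set.ncard_coe_finset]
  have hdep : dep (D.minBag dep h) = d := (D.dep_minBag dep h).trans hh.1
  split_ifs with hd0
  · subst hd0
    refine le_of_eq ?_
    rw [rootWidth]
    congr 2
    -- In round 0 the whole tree is one component, so the root is the only bag of depth 0.
    obtain ⟨w⟩ := D.isTree.connected.preconnected D.root (D.minBag dep h)
    refine hd.at_most_one D.root _ ⟨w, fun y _ => ?_⟩ (by rw [hdep, hd.root_depth])
    rw [hd.root_depth]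
    exact Nat.zero_le _
  · refine D.card_bag_le _ fun hroot => hd0 ?_
    rw [← hdep, hroot, hd.root_depth]

/-- The halving starts only at depth 1, since the root bag need not be a centroid; hence the shift
between the exponent and the depth. -/
theorem IsCentroidDepth.two_pow_mul_ncard_le [Fintype V] (hd : D.IsCentroidDepth dep) (d : ℕ) :
    ∀ t, dep t = d + 1 → 2 ^ d * (D.population (D.part dep t)).ncard ≤ Fintype.card V := by
  induction d with
  | zero =>
    intro t _
    rw [pow_zero, one_mul, ← Nat.card_eq_fintype_card]
    exact Set.ncard_le_card _
  | succ d ih =>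
    intro t ht
    obtain ⟨s, hs, hst⟩ := hd.at_least_one t (d + 1) (by omega)
    have h1 := hd.centroid s t (by rintro rfl; rw [hd.root_depth] at hs; omega) hst (by omega)
    calc 2 ^ (d + 1) * (D.population (D.part dep t)).ncard
        = 2 ^ d * (2 * (D.population (D.part dep t)).ncard) := by ring
      _ ≤ 2 ^ d * (D.population (D.part dep s)).ncard := Nat.mul_le_mul_left _ h1
      _ ≤ _ := ih s hs

theorem IsCentroidDepth.two_pow_mul_ncard_reachSet_le [Fintype V] (hd : D.IsCentroidDepth dep)
    {d : ℕ} {h : V} (hh : D.level dep h = d + 1) :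
    2 ^ d * (D.reachSet dep h).ncard ≤ Fintype.card V :=
  hd.two_pow_mul_ncard_le d _ ((D.dep_minBag dep h).trans hh)

-- Double counting of the pairs of a hub of level `d` and a vertex in its `reachSet`.
open scoped Classical in
theorem IsCentroidDepth.sum_ncard_reachSet_le [Fintype V] (hd : D.IsCentroidDepth dep) (d : ℕ) :
    ∑ h with D.level dep h = d, (D.reachSet dep h).ncard ≤
      Fintype.card V * if d = 0 then D.rootWidth else c := by
  have h1 : ∀ h, (D.reachSet dep h).ncard = ∑ x : V, if x ∈ D.reachSet dep h then 1 else 0 := by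
    intro h
    rw [Finset.sum_boole, Nat.cast_id, ← Set.ncard_coe_finset]
    congr 1
    ext; simp
  simp only [h1]
  rw [Finset.sum_comm, ← Finset.card_univ, ← smul_eq_mul]
  refine Finset.sum_le_card_nsmul _ _ _ fun x _ => ?_
  refine le_trans (le_of_eq ?_) (hd.ncard_hubs_le d x)
  rw [Finset.sum_boole, Nat.cast_id, ← Set.ncard_coe_finset]
  congr 1
  ext; simp

end RelaxedTreeDecomposition

theorem LowReach.mem_reachSet {V : Type u} [Fintype V] {W : WeightedGraph V} {ι : Type v} {c : ℕ}
    {D : RelaxedTreeDecomposition W.graph ι c} {dep : ι → ℕ} {R : Ranking V}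
    (hR : R.DeterminedBy D dep) {h x : V} (hx : LowReach W R h x) : x ∈ D.reachSet dep h := by
  induction hx with
  | refl => exact RelaxedTreeDecomposition.self_mem_reachSet h
  | tail _ hxy ih =>
    refine RelaxedTreeDecomposition.mem_reachSet_of_adj ih hxy.1 ?_
    by_contra hlt
    exact absurd (hR _ _ (not_le.mp hlt)) (not_lt.mpr hxy.2)

/-! ### Rankings sorted by a key, and the circular distribution of roots. -/

namespace Ranking

variable {V : Type u} [Fintype V]

theorem exists_of_key {α : Type*} [LinearOrder α] (key : V → α) :
    ∃ R : Ranking V, ∀ x y, key x < key y → R.rank x < R.rank y := by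
  let e := Fintype.equivFin V
  let σ := Tuple.sort (key ∘ e.symm)
  refine ⟨e.trans σ.symm, fun x y hxy => ?_⟩
  by_contra hle
  have h : (e.trans σ.symm) y ≤ (e.trans σ.symm) x := by
    rw [Fin.le_def]
    exact Nat.le_of_succ_le_succ (not_lt.mp hle)
  have := Tuple.monotone_sort (key ∘ e.symm) h
  simp only [Function.comp_apply, Equiv.trans_apply] at this
  change key (e.symm (σ (σ.symm (e y)))) ≤ key (e.symm (σ (σ.symm (e x)))) at this
  simp only [Equiv.apply_symm_apply, Equiv.symm_apply_apply] at this
  exact absurd hxy (not_lt.mpr this)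

theorem exists_rank_eq (R : Ranking V) {r : ℕ} (h1 : 1 ≤ r) {z : V} (hz : r ≤ R.rank z) :
    ∃ y, R.rank y = r := by
  have hlt : r - 1 < Fintype.card V := by
    have := (R z).isLt
    unfold rank at hz
    omega
  refine ⟨R.symm ⟨r - 1, hlt⟩, ?_⟩
  simp only [rank, Equiv.apply_symm_apply]
  omega

theorem card_block (R : Ranking V) (q : ℕ) {h z : V} (hz : R.rank h + q ≤ R.rank z) :
    q ≤ (Finset.univ.filter fun y => R.rank h ≤ R.rank y ∧ R.rank y < R.rank h + q).card := by
  classical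
  calc q = (Finset.Ico (R.rank h) (R.rank h + q)).card := by simp
    _ ≤ ((Finset.univ.filter fun y =>
          R.rank h ≤ R.rank y ∧ R.rank y < R.rank h + q).image R.rank).card := by
        refine Finset.card_le_card fun r hr => ?_
        rw [Finset.mem_Ico] at hr
        obtain ⟨y, rfl⟩ := R.exists_rank_eq (le_trans (Nat.succ_pos _) hr.1)
          (hr.2.le.trans hz)
        exact Finset.mem_image_of_mem _ (by simpa using hr)
    _ ≤ _ := Finset.card_image_le

/-- If `f` increases with the rank on an interval `H` of the ranking, then in a circular
distribution of `H` onto `q` nodes the share of every node is at most the average share plus the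
maximum of `f`. -/
theorem mul_sum_owned_le (R : Ranking V) (q i : ℕ) (H : Finset V) (f : V → ℕ) (M : ℕ)
    (hH : ∀ x ∈ H, ∀ z ∈ H, ∀ y, R.rank x ≤ R.rank y → R.rank y ≤ R.rank z → y ∈ H)
    (hf : ∀ x ∈ H, ∀ y ∈ H, R.rank x ≤ R.rank y → f x ≤ f y) (hM : ∀ x ∈ H, f x ≤ M) :
    q * ∑ h ∈ H with R.rank h % q = i, f h ≤ q * M + ∑ h ∈ H, f h := by
  classical
  set O := H.filter fun h => R.rank h % q = i with hO
  rcases O.eq_empty_or_nonempty with h0 | hne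
  · simp [h0]
  -- The topmost owned root `z` pays the term `M`: the `q` ranks starting at `z` may leave `H`.
  obtain ⟨z, hz, hmax⟩ := O.exists_max_image R.rank hne
  have hOH : ∀ {x}, x ∈ O → x ∈ H := fun hx => (Finset.mem_filter.mp hx).1
  have hgap : ∀ x ∈ O, ∀ y ∈ O, R.rank x < R.rank y → R.rank x + q ≤ R.rank y := by
    intro x hx y hy hxy
    have hmod : R.rank x ≡ R.rank y [MOD q] :=
      (Finset.mem_filter.mp hx).2.trans (Finset.mem_filter.mp hy).2.symm
    have := Nat.le_of_dvd (Nat.sub_pos_of_lt hxy) ((Nat.modEq_iff_dvd' hxy.le).mp hmod)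
    omega
  have htop : ∀ x ∈ O.erase z, R.rank x + q ≤ R.rank z := by
    intro x hx
    have hx' := Finset.mem_of_mem_erase hx
    refine hgap x hx' z hz (lt_of_le_of_ne (hmax x hx') fun h => ?_)
    exact Finset.ne_of_mem_erase hx (R.rank_injective h)
  -- Every other owned root is charged to the block of `q` consecutive ranks starting at it. Owned
  -- ranks are at least `q` apart, so the blocks are disjoint, and `f` on a block is at least its
  -- value at the start.
  let B : V → Finset V := fun h =>
    Finset.univ.filter fun y => R.rank h ≤ R.rank y ∧ R.rank y < R.rank h + q
  have hB : ∀ {h y}, y ∈ B h ↔ R.rank h ≤ R.rank y ∧ R.rank y < R.rank h + q := by simp [B]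
  have hBH : ∀ x ∈ O.erase z, B x ⊆ H := fun x hx y hy =>
    hH x (hOH (Finset.mem_of_mem_erase hx)) z (hOH hz) y (hB.mp hy).1
      ((hB.mp hy).2.le.trans (htop x hx))
  have hdisj : (↑(O.erase z) : Set V).PairwiseDisjoint B := by
    intro x hx y hy hxy
    refine Finset.disjoint_left.mpr fun w hw hw' => ?_
    have hx' := Finset.mem_of_mem_erase hx
    have hy' := Finset.mem_of_mem_erase hy
    rw [hB] at hw hw'
    rcases lt_trichotomy (R.rank x) (R.rank y) with h | h | h
    · have := hgap x hx' y hy' h; omega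
    · exact hxy (R.rank_injective h)
    · have := hgap y hy' x hx' h; omega
  have hsum : q * ∑ h ∈ O.erase z, f h ≤ ∑ h ∈ H, f h :=
    calc q * ∑ h ∈ O.erase z, f h = ∑ h ∈ O.erase z, q * f h := Finset.mul_sum _ _ _
      _ ≤ ∑ h ∈ O.erase z, ∑ y ∈ B h, f y := by
          refine Finset.sum_le_sum fun x hx => ?_
          refine (Nat.mul_le_mul_right _ (R.card_block q (htop x hx))).trans ?_
          rw [← smul_eq_mul]
          exact Finset.card_nsmul_le_sum _ _ _ fun y hy =>
            hf x (hOH (Finset.mem_of_mem_erase hx)) y (hBH x hx hy) (hB.mp hy).1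
      _ = ∑ y ∈ (O.erase z).biUnion B, f y := (Finset.sum_biUnion hdisj).symm
      _ ≤ _ := Finset.sum_le_sum_of_subset (Finset.biUnion_subset.mpr hBH)
  rw [← Finset.add_sum_erase O f hz, mul_add]
  exact add_le_add (Nat.mul_le_mul_left _ (hM z (hOH hz))) hsum

end Ranking

/-! ### Counting the hub-vertex pairs owned by one node. -/

section Count

variable {V : Type u} [Fintype V] {W : WeightedGraph V} {ι : Type v} {c : ℕ}
  {D : RelaxedTreeDecomposition W.graph ι c} {dep : ι → ℕ} {R : Ranking V}

/-- Vertices whose minimum-depth bag has a larger component are ranked higher within a level. -/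
def SortedWithinLevels (R : Ranking V) (D : RelaxedTreeDecomposition W.graph ι c)
    (dep : ι → ℕ) : Prop :=
  ∀ x y, D.level dep x = D.level dep y →
    (D.reachSet dep x).ncard < (D.reachSet dep y).ncard → R.rank x < R.rank y

theorem exists_ranking (D : RelaxedTreeDecomposition W.graph ι c) (dep : ι → ℕ) :
    ∃ R : Ranking V, R.DeterminedBy D dep ∧ SortedWithinLevels R D dep := by
  -- Lexicographic key: smaller levels rank higher, hence the order dual; ties are broken by the
  -- size of `reachSet`.
  obtain ⟨R, hR⟩ := Ranking.exists_of_key fun x : V =>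
    toLex (OrderDual.toDual (D.level dep x), (D.reachSet dep x).ncard)
  refine ⟨R, fun x y h => hR y x ?_, fun x y h h' => hR x y ?_⟩
  · exact Prod.Lex.toLex_lt_toLex.mpr (Or.inl h)
  · exact Prod.Lex.toLex_lt_toLex.mpr (Or.inr ⟨congrArg OrderDual.toDual h, h'⟩)

theorem RelaxedTreeDecomposition.IsCentroidDepth.level_lt (hd : D.IsCentroidDepth dep) (h : V) :
    D.level dep h < Nat.log 2 (Fintype.card V) + 2 := by
  rcases hl : D.level dep h with _ | d
  · omega
  · have h1 := hd.two_pow_mul_ncard_reachSet_le hl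
    have h2 : 0 < (D.reachSet dep h).ncard :=
      (Set.ncard_pos (Set.toFinite _)).mpr ⟨h, RelaxedTreeDecomposition.self_mem_reachSet h⟩
    have h3 : 2 ^ d ≤ Fintype.card V := (Nat.le_mul_of_pos_right _ h2).trans h1
    have := Nat.le_log_of_pow_le one_lt_two h3
    omega

open scoped Classical in
theorem mul_sum_owned_reachSet_le (hd : D.IsCentroidDepth dep) (hR : R.DeterminedBy D dep)
    (hS : SortedWithinLevels R D dep) (q i : ℕ) :
    q * ∑ h with R.rank h % q = i, (D.reachSet dep h).ncard ≤
      q * (3 * Fintype.card V) + (Fintype.card V * D.rootWidth +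
        (Nat.log 2 (Fintype.card V) + 1) * (Fintype.card V * c)) := by
  set n := Fintype.card V with hn
  have hlevel : ∀ d M, (∀ h, D.level dep h = d → (D.reachSet dep h).ncard ≤ M) →
      q * ∑ h ∈ (Finset.univ.filter fun h => R.rank h % q = i) with D.level dep h = d,
        (D.reachSet dep h).ncard ≤ q * M + n * if d = 0 then D.rootWidth else c := by
    intro d M hM
    refine le_trans ?_ (Nat.add_le_add_left (hd.sum_ncard_reachSet_le d) _)
    rw [Finset.filter_comm]
    refine R.mul_sum_owned_le q i _ _ M ?_ ?_ ?_
    · intro x hx z hz y hxy hyz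
      simp only [Finset.mem_filter, Finset.mem_univ, true_and] at hx hz ⊢
      -- A level occupies an interval of ranks because the ranking is monotone in the level.
      rcases lt_trichotomy (D.level dep y) d with h | h | h
      · exact absurd (hR y z (by rwa [hz])) (not_lt.mpr hyz)
      · exact h
      · exact absurd (hR x y (by rwa [hx])) (not_lt.mpr hxy)
    · intro x hx y hy hxy
      simp only [Finset.mem_filter, Finset.mem_univ, true_and] at hx hy
      by_contra hlt
      exact absurd (hS y x (hy.trans hx.symm) (not_le.mp hlt)) (not_lt.mpr hxy)
    · intro x hx
      simp only [Finset.mem_filter, Finset.mem_univ, true_and] at hx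
      exact hM x hx
  have hmaps : ∀ h ∈ Finset.univ.filter fun h => R.rank h % q = i,
      D.level dep h ∈ Finset.range (Nat.log 2 n + 2) :=
    fun h _ => Finset.mem_range.mpr (hd.level_lt h)
  rw [← Finset.sum_fiberwise_of_maps_to hmaps, Finset.sum_range_succ', mul_add, Finset.mul_sum]
  have h0 := hlevel 0 n fun h _ => by
    rw [hn, ← Nat.card_eq_fintype_card]
    exact Set.ncard_le_card _
  have h1 : ∀ d, _ := fun d => hlevel (d + 1) (n / 2 ^ d) fun h hh => by
    rw [Nat.le_div_iff_mul_le (by positivity), mul_comm]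
    exact hd.two_pow_mul_ncard_reachSet_le hh
  refine (add_le_add (Finset.sum_le_sum fun d _ => h1 d) h0).trans ?_
  simp only [Nat.succ_ne_zero, if_false, if_true, Finset.sum_add_distrib, ← Finset.mul_sum,
    Finset.sum_const, Finset.card_range, smul_eq_mul]
  -- The maxima of the levels from 1 on form a geometric series; with the `n` of level 0 this gives
  -- `3 * n`.
  have hgeom : ∑ d ∈ Finset.range (Nat.log 2 n + 1), n / 2 ^ d ≤ n * 2 := by
    simpa using Nat.geom_sum_le le_rfl n (Nat.log 2 n + 1)
  have := Nat.mul_le_mul_left q hgeom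
  nlinarith

theorem natLog_add_one_le {n : ℕ} (hn : 2 ≤ n) : (Nat.log 2 n : ℝ) + 1 ≤ 3 * Real.log n := by
  have h1 : (2 : ℝ) ^ Nat.log 2 n ≤ n := by exact_mod_cast Nat.pow_log_le_self 2 (by omega)
  have h2 := Real.log_le_log (by positivity) h1
  rw [Real.log_pow] at h2
  have h3 : Real.log 2 ≤ Real.log n := Real.log_le_log two_pos (by exact_mod_cast hn)
  have h4 := Real.log_two_gt_d9
  have h5 : (0 : ℝ) ≤ Nat.log 2 n := Nat.cast_nonneg _
  nlinarith

/-- The average number of labels per node, up to a constant factor, and an additive `O(n)`. -/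
theorem sum_owned_reachSet_le [Nonempty V] (hd : D.IsCentroidDepth dep)
    (hR : R.DeterminedBy D dep) (hS : SortedWithinLevels R D dep) {q : ℕ} (hq : 0 < q) (i : ℕ) :
    ((∑ h with R.rank h % q = i, (D.reachSet dep h).ncard : ℕ) : ℝ) ≤
      3 * ((Fintype.card V : ℝ) * (D.rootWidth + c * Real.log (Fintype.card V)) / q
        + Fintype.card V) := by
  have h := mul_sum_owned_reachSet_le hd hR hS q i
  set L := ∑ h with R.rank h % q = i, (D.reachSet dep h).ncard with hL
  set n := Fintype.card V with hn
  have hn0 : 0 < n := Fintype.card_pos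
  have hq' : (0 : ℝ) < q := by exact_mod_cast hq
  have hlog : 0 ≤ Real.log n := Real.log_natCast_nonneg n
  -- For `n = 1` the logarithm vanishes and cannot absorb the term of level 1; the additive `n`
  -- covers the single possible pair.
  rcases Nat.lt_or_ge n 2 with h1 | h2
  · have hn1 : n = 1 := by omega
    have hL1 : L ≤ n * n := by
      refine (Finset.sum_le_card_nsmul _ _ n fun h _ => ?_).trans
        (Nat.mul_le_mul_right _ (Finset.card_le_univ _))
      rw [hn, ← Nat.card_eq_fintype_card]
      exact Set.ncard_le_card _
    rw [hn1] at hL1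
    have hL1' : (L : ℝ) ≤ 1 := by exact_mod_cast hL1
    have : 0 ≤ (n : ℝ) * (D.rootWidth + c * Real.log n) / q := by positivity
    have hn1' : (n : ℝ) = 1 := by exact_mod_cast hn1
    linarith
  · have hlog' := natLog_add_one_le h2
    have hreal : (q : ℝ) * L ≤ q * (3 * n) + (n * D.rootWidth + (Nat.log 2 n + 1) * (n * c)) := by
      exact_mod_cast h
    have hmul := mul_le_mul_of_nonneg_right hlog' (by positivity : (0 : ℝ) ≤ n * c)
    have hw : (0 : ℝ) ≤ n * D.rootWidth := by positivity
    have hgoal : (q : ℝ) * L ≤ q * (3 * (n * (D.rootWidth + c * Real.log n) / q + n)) := by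
      have : (q : ℝ) * (3 * (n * (D.rootWidth + c * Real.log n) / q + n)) =
          3 * (n * (D.rootWidth + c * Real.log n)) + q * (3 * n) := by
        field_simp
      rw [this]
      nlinarith
    exact le_of_mul_le_mul_left hgoal hq'

end Count

end

end HubLabeling

open HubLabeling in
theorem mainTheorem7 (p : ℕ) :
    ∃ C : ℝ, ∀ (V : Type*) [Fintype V] [DecidableEq V] [Nonempty V] (W : WeightedGraph V)
      (ι : Type*) [Finite ι] (c : ℕ) (D : RelaxedTreeDecomposition W.graph ι c),
      (∃ dep : ι → ℕ, D.IsCentroidDepth dep) ∧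
      ∀ dep : ι → ℕ, D.IsCentroidDepth dep →
        ∃ R : Ranking V, R.DeterminedBy D dep ∧
          ∀ (q : ℕ) (P : Schedule) (K : Cluster V q p), K.Occurs W R P → ∀ i : Fin q,
            (K.nodeMemory W i : ℝ) ≤
              C * ((Fintype.card V : ℝ) * (D.rootWidth + c * Real.log (Fintype.card V)) / q
                + Fintype.card V + W.graph.edgeSet.ncard) := by
  classical
  -- Four words per label, with at most `3 * (X + n)` labels, give `12 * X + 12 * n`. The remaining
  -- memory adds `(12 + 6 * p) * n + 4 * m` and `2 * p ≤ 2 * p * n`.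
  refine ⟨24 + 8 * p, fun V _ _ _ W ι _ c D =>
    ⟨⟨_, D.isCentroidDepth_removalDepth⟩, fun dep hd => ?_⟩⟩
  obtain ⟨R, hR, hS⟩ := exists_ranking D dep
  refine ⟨R, hR, fun q P K hK i => ?_⟩
  have hmem : (K.nodeMemory W i : ℝ) ≤ 4 * (K.node i).labels.card
      + (12 + 6 * p) * Fintype.card V + 2 * p + 4 * W.graph.edgeSet.ncard := by
    exact_mod_cast hK.nodeMemory_le i
  have hlab := (hK.valid.1 i).card_labels_le (fun h => (D.reachSet dep h).toFinset)
    fun h x hx => by simpa using hx.mem_reachSet hR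
  simp only [← Set.ncard_eq_toFinset_card'] at hlab
  have hsum := sum_owned_reachSet_le hd hR hS i.pos i
  have hlab' := (Nat.cast_le (α := ℝ)).mpr hlab
  have hn : (1 : ℝ) ≤ Fintype.card V := by exact_mod_cast Fintype.card_pos (α := V)
  have hlog : 0 ≤ Real.log (Fintype.card V) := Real.log_natCast_nonneg _
  have hX : 0 ≤ (Fintype.card V : ℝ) * (D.rootWidth + c * Real.log (Fintype.card V)) / q := by
    positivity
  generalize (Fintype.card V : ℝ) * (D.rootWidth + c * Real.log (Fintype.card V)) / q = X at *
  have hp : (0 : ℝ) ≤ p := p.cast_nonneg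
  have hm : (0 : ℝ) ≤ W.graph.edgeSet.ncard := Nat.cast_nonneg _
  have h1 := mul_nonneg hp hX
  have h2 := mul_nonneg hp hm
  have h3 := mul_le_mul_of_nonneg_left hn hp
  nlinarith
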